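/- Let $\mu$ be a nonzero integer, and let $S_n=S_n(z;\mu)\in\mathbb{C}(z)$, $n\ge -1$, be the rational functions determined by $S_{-1}=S_0=1$ and the recurrence relation $$S_{n+1}S_{n-1}=-z\left[S_n\frac{d^2S_n}{dz^2}-\left(\frac{dS_n}{dz}\right)^2\right]-S_n\frac{dS_n}{dz}+(z+\mu)S_n^2,\qquad n\ge 0.$$ Let $n\ge|\mu|$, and suppose that $S_n(z)=z^\sigma g(z)$, where $\sigma$ is an integer and $g(z)=\sum_{j=0}^k a_jz^j$ is a polynomial with complex coefficients and $a_0\ne 0$ (put $a_j=0$ for $j>k$). Then (a) $a_1=\mu a_0$; and (b) if $\sigma=\tfrac12(n-|\mu|)(n-|\mu|+1)$, then, with $m=n-|\mu|$, $$a_2=\tfrac12\left(\mu^2-\frac{|\mu|}{2m+1}\right)a_0.$$ -/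

import Mathlib

noncomputable section

/-- The derivative `d/dz` on the field `ℂ(z)` of rational functions, by the quotient rule applied
to the reduced fraction. -/
def ratDeriv (f : RatFunc ℂ) : RatFunc ℂ :=
  algebraMap (Polynomial ℂ) (RatFunc ℂ)
      (Polynomial.derivative f.num * f.denom - f.num * Polynomial.derivative f.denom) /
    algebraMap (Polynomial ℂ) (RatFunc ℂ) (f.denom ^ 2)

/-- `ratDeriv` obeys the quotient rule on every fraction, reduced or not. -/
theorem ratDeriv_div (p q : Polynomial ℂ) (hq : q ≠ 0) :
    ratDeriv (algebraMap (Polynomial ℂ) (RatFunc ℂ) p / algebraMap (Polynomial ℂ) (RatFunc ℂ) q) =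
      algebraMap (Polynomial ℂ) (RatFunc ℂ)
          (Polynomial.derivative p * q - p * Polynomial.derivative q) /
        algebraMap (Polynomial ℂ) (RatFunc ℂ) (q ^ 2) := by
  generalize hf : algebraMap (Polynomial ℂ) (RatFunc ℂ) p / algebraMap (Polynomial ℂ) (RatFunc ℂ) q
    = f
  have hd : f.denom ≠ 0 := RatFunc.denom_ne_zero f
  have h : f.num * q = p * f.denom := (RatFunc.num_mul_eq_mul_denom_iff hq).2 hf.symm
  have h' := congrArg Polynomial.derivative h
  rw [Polynomial.derivative_mul, Polynomial.derivative_mul] at h'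
  have e : (Polynomial.derivative f.num * f.denom - f.num * Polynomial.derivative f.denom) * q ^ 2 =
      (Polynomial.derivative p * q - p * Polynomial.derivative q) * f.denom ^ 2 := by
    linear_combination (f.denom * q) * h' -
      (q * Polynomial.derivative f.denom + f.denom * Polynomial.derivative q) * h
  have e' := congrArg (algebraMap (Polynomial ℂ) (RatFunc ℂ)) e
  rw [map_mul, map_mul (algebraMap (Polynomial ℂ) (RatFunc ℂ))] at e'
  exact (div_eq_div_iff (RatFunc.algebraMap_ne_zero (pow_ne_zero 2 hd))
    (RatFunc.algebraMap_ne_zero (pow_ne_zero 2 hq))).2 e'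

/-- On polynomials `ratDeriv` is the usual derivative. -/
theorem ratDeriv_algebraMap (p : Polynomial ℂ) :
    ratDeriv (algebraMap (Polynomial ℂ) (RatFunc ℂ) p) =
      algebraMap (Polynomial ℂ) (RatFunc ℂ) (Polynomial.derivative p) := by
  simpa using ratDeriv_div p 1 one_ne_zero

/-- The right-hand side `-z (S S'' - (S')²) - S S' + (z + μ) S²` of the recurrence relation. -/
def umemuraRHS (μ : ℂ) (S : RatFunc ℂ) : RatFunc ℂ :=
  -RatFunc.X * (S * ratDeriv (ratDeriv S) - ratDeriv S ^ 2) - S * ratDeriv S +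
    (RatFunc.X + RatFunc.C μ) * S ^ 2

/-- The rational functions `S_n(z; μ)`, `n ≥ 0`, given by the recurrence relation
`S_{n+1} S_{n-1} = -z (S_n S_n'' - (S_n')²) - S_n S_n' + (z + μ) S_n²` and the initial values
`S_{-1} = S_0 = 1`; so `S_1` is the right-hand side at `S_0`, divided by `S_{-1} = 1`. -/
def umemuraS (μ : ℂ) : ℕ → RatFunc ℂ
  | 0 => 1
  | 1 => umemuraRHS μ 1
  | n + 2 => umemuraRHS μ (umemuraS μ (n + 1)) / umemuraS μ n

/-- The right-hand side of the recurrence relation does not vanish at a nonzero `S`. -/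
theorem umemuraRHS_ne_zero (μ : ℂ) (f : RatFunc ℂ) (hf : f ≠ 0) : umemuraRHS μ f ≠ 0 := by
  obtain ⟨p, q, hp, hq, rfl⟩ : ∃ p q : Polynomial ℂ, p ≠ 0 ∧ q ≠ 0 ∧
      f = algebraMap (Polynomial ℂ) (RatFunc ℂ) p / algebraMap (Polynomial ℂ) (RatFunc ℂ) q :=
    ⟨f.num, f.denom, RatFunc.num_ne_zero hf, f.denom_ne_zero, (RatFunc.num_div_denom f).symm⟩
  have hq' : algebraMap (Polynomial ℂ) (RatFunc ℂ) q ≠ 0 := RatFunc.algebraMap_ne_zero hq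
  obtain ⟨A, hA⟩ : ∃ A, A = Polynomial.derivative p * q - p * Polynomial.derivative q := ⟨_, rfl⟩
  obtain ⟨B, hB⟩ : ∃ B, B = Polynomial.X * (p * Polynomial.derivative A * q -
      2 * (p * A * Polynomial.derivative q) - A ^ 2) + p * A * q := ⟨_, rfl⟩
  have key : umemuraRHS μ (algebraMap (Polynomial ℂ) (RatFunc ℂ) p /
      algebraMap (Polynomial ℂ) (RatFunc ℂ) q) = algebraMap (Polynomial ℂ) (RatFunc ℂ)
        ((Polynomial.X + Polynomial.C μ) * (p * q) ^ 2 - B) /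
          algebraMap (Polynomial ℂ) (RatFunc ℂ) (q ^ 4) := by
    unfold umemuraRHS
    rw [ratDeriv_div p q hq, ← hA, ratDeriv_div A (q ^ 2) (pow_ne_zero 2 hq), hB]
    simp only [map_sub, map_add, map_mul, map_pow, map_ofNat, Polynomial.derivative_pow,
      RatFunc.algebraMap_X, RatFunc.algebraMap_C, Nat.cast_ofNat, Nat.add_one_sub_one, pow_one]
    field_simp
    ring
  rw [key]
  refine div_ne_zero (RatFunc.algebraMap_ne_zero ?_) (RatFunc.algebraMap_ne_zero (pow_ne_zero 4 hq))
  have hdp := Polynomial.natDegree_derivative_le p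
  have hdq := Polynomial.natDegree_derivative_le q
  have hdA := Polynomial.natDegree_derivative_le A
  have hpq : ((p * q) ^ 2).natDegree = 2 * (p.natDegree + q.natDegree) := by
    rw [Polynomial.natDegree_pow, Polynomial.natDegree_mul hp hq]
  have hBdeg : B.natDegree ≤ 2 * (p.natDegree + q.natDegree) := by
    by_cases hA0 : A = 0
    · simp [hB, hA0]
    have hab : p.natDegree + q.natDegree ≠ 0 := by
      intro h
      apply hA0
      rw [hA, Polynomial.derivative_of_natDegree_zero (by omega),
        Polynomial.derivative_of_natDegree_zero (by omega)]
      simp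
    have hAdeg : A.natDegree ≤ p.natDegree + q.natDegree - 1 := by
      rw [hA]
      refine (Polynomial.natDegree_sub_le _ _).trans (max_le ?_ ?_)
      · by_cases h : p.natDegree = 0
        · simp [Polynomial.derivative_of_natDegree_zero h]
        · exact Polynomial.natDegree_mul_le.trans (by omega)
      · by_cases h : q.natDegree = 0
        · simp [Polynomial.derivative_of_natDegree_zero h]
        · exact Polynomial.natDegree_mul_le.trans (by omega)
    have h1 : (p * Polynomial.derivative A * q).natDegree ≤
        2 * (p.natDegree + q.natDegree) - 1 := by
      refine Polynomial.natDegree_mul_le.trans ?_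
      have := Polynomial.natDegree_mul_le (p := p) (q := Polynomial.derivative A)
      omega
    have h2 : (2 * (p * A * Polynomial.derivative q)).natDegree ≤
        2 * (p.natDegree + q.natDegree) - 1 := by
      refine Polynomial.natDegree_mul_le.trans ?_
      have t1 := Polynomial.natDegree_mul_le (p := p * A) (q := Polynomial.derivative q)
      have t2 := Polynomial.natDegree_mul_le (p := p) (q := A)
      have t3 : (2 : Polynomial ℂ).natDegree = 0 := Polynomial.natDegree_ofNat 2
      omega
    have h3 : (A ^ 2).natDegree ≤ 2 * (p.natDegree + q.natDegree) - 1 := by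
      rw [Polynomial.natDegree_pow]
      omega
    have h4 : (p * A * q).natDegree ≤ 2 * (p.natDegree + q.natDegree) := by
      refine Polynomial.natDegree_mul_le.trans ?_
      have := Polynomial.natDegree_mul_le (p := p) (q := A)
      omega
    rw [hB]
    refine (Polynomial.natDegree_add_le _ _).trans (max_le ?_ h4)
    have h5 := (Polynomial.natDegree_sub_le _ _).trans
      (max_le ((Polynomial.natDegree_sub_le _ _).trans (max_le h1 h2)) h3)
    refine Polynomial.natDegree_mul_le.trans ?_
    rw [Polynomial.natDegree_X]
    omega
  intro h0
  have h1 := congrArg Polynomial.natDegree (sub_eq_zero.1 h0)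
  rw [Polynomial.natDegree_mul (Polynomial.X_add_C_ne_zero μ) (pow_ne_zero 2 (mul_ne_zero hp hq)),
    Polynomial.natDegree_X_add_C, hpq] at h1
  omega

/-- No `S_n` is the zero function. -/
theorem umemuraS_ne_zero (μ : ℂ) : ∀ n, umemuraS μ n ≠ 0
  | 0 => by simp [umemuraS]
  | 1 => by simpa [umemuraS] using umemuraRHS_ne_zero μ 1 one_ne_zero
  | n + 2 => by
    rw [umemuraS]
    exact div_ne_zero (umemuraRHS_ne_zero μ _ (umemuraS_ne_zero μ (n + 1))) (umemuraS_ne_zero μ n)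

/-- No division by zero occurs in `umemuraS`: the recurrence relation holds. -/
theorem umemuraS_mul (μ : ℂ) (n : ℕ) :
    umemuraS μ (n + 2) * umemuraS μ n = umemuraRHS μ (umemuraS μ (n + 1)) := by
  rw [umemuraS, div_mul_cancel₀ _ (umemuraS_ne_zero μ n)]

end

noncomputable section

/-! ### The derivation of `ℂ(z)` -/

/-! Put $u_n = zS_n'/S_n$ and $F_n = S_{n+1}S_{n-1}/S_n^2$. The recurrence becomes $F_n =
z+\mu-u_n'$, and logarithmic differentiation gives $zF_n' = F_n(u_{n+1}-2u_n+u_{n-1})$, a Toda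
chain. Because $u_{-1}=u_0=0$, it has the first integral $F_n(u_{n+1}-u_{n-1})=(2n+1)z$
(`toda_integrals`).

Each $u_n$ is regular at the origin, say $u_n=a_n+b_nz+c_nz^2+\cdots$, so
$F_n=(\mu-b_n)+(1-2c_n)z+\cdots$. While $\mu-b_n\ne0$, the integral keeps $a_n=0$ and gives
$(\mu-b_n)(\mu-b_{n-1})=\mu^2-n^2$ (`toda_coeff_subcritical`). This product first vanishes at
$n=|\mu|$, where $b_n=\mu$. From there on, the integral and the chain equation together keep
$b_n=\mu$, make $a_n$ run through the triangular numbers and yield $c_n=-|\mu|/(2m+1)$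
(`toda_coeff_supercritical`).

If $S_n=z^\sigma g$, then $g(u_n-\sigma)=zg'$, and comparing coefficients gives $a_1$ and $a_2$. In
the code, sequences such as `u` start at $S_{-1}$, so index $n+1$ belongs to $S_n$, while `F n`
belongs to $S_n$ itself. -/

theorem ratDeriv_add (f g : RatFunc ℂ) : ratDeriv (f + g) = ratDeriv f + ratDeriv g := by
  have hf := RatFunc.algebraMap_ne_zero f.denom_ne_zero
  have hg := RatFunc.algebraMap_ne_zero g.denom_ne_zero
  have key : f + g = algebraMap (Polynomial ℂ) (RatFunc ℂ) (f.num * g.denom + g.num * f.denom) /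
      algebraMap (Polynomial ℂ) (RatFunc ℂ) (f.denom * g.denom) := by
    conv_lhs => rw [← RatFunc.num_div_denom f, ← RatFunc.num_div_denom g]
    rw [div_add_div _ _ hf hg]
    simp only [map_mul, map_add]
    ring
  rw [key, ratDeriv_div _ _ (mul_ne_zero f.denom_ne_zero g.denom_ne_zero), ratDeriv, ratDeriv]
  simp only [Polynomial.derivative_mul, map_add, map_sub, map_mul, map_pow]
  field_simp
  ring

theorem ratDeriv_mul (f g : RatFunc ℂ) :
    ratDeriv (f * g) = f * ratDeriv g + g * ratDeriv f := by
  have hf := RatFunc.algebraMap_ne_zero f.denom_ne_zero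
  have hg := RatFunc.algebraMap_ne_zero g.denom_ne_zero
  have key : f * g = algebraMap (Polynomial ℂ) (RatFunc ℂ) (f.num * g.num) /
      algebraMap (Polynomial ℂ) (RatFunc ℂ) (f.denom * g.denom) := by
    conv_lhs => rw [← RatFunc.num_div_denom f, ← RatFunc.num_div_denom g]
    rw [div_mul_div_comm, map_mul, map_mul]
  rw [key, ratDeriv_div _ _ (mul_ne_zero f.denom_ne_zero g.denom_ne_zero), ratDeriv, ratDeriv]
  have ef : f * algebraMap _ _ f.denom = algebraMap (Polynomial ℂ) (RatFunc ℂ) f.num :=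
    (div_eq_iff hf).1 (RatFunc.num_div_denom f) |>.symm
  have eg : g * algebraMap _ _ g.denom = algebraMap (Polynomial ℂ) (RatFunc ℂ) g.num :=
    (div_eq_iff hg).1 (RatFunc.num_div_denom g) |>.symm
  simp only [Polynomial.derivative_mul, map_add, map_sub, map_mul, map_pow]
  field_simp
  rw [← ef, ← eg]
  ring

/-- `ratDeriv` as a derivation. -/
def ratDerivation : Derivation ℂ (RatFunc ℂ) (RatFunc ℂ) :=
  Derivation.mk'
    { toFun := ratDeriv
      map_add' := ratDeriv_add
      map_smul' := fun c f => by
        rw [RatFunc.smul_eq_C_mul, RatFunc.smul_eq_C_mul, ratDeriv_mul, ← RatFunc.algebraMap_C,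
          ratDeriv_algebraMap]
        simp }
    ratDeriv_mul

theorem ratDerivation_apply (f : RatFunc ℂ) : ratDerivation f = ratDeriv f := rfl

theorem ratDerivation_X : ratDerivation RatFunc.X = 1 := by
  rw [ratDerivation_apply, ← RatFunc.algebraMap_X, ratDeriv_algebraMap]
  simp

theorem ratDerivation_C (c : ℂ) : ratDerivation (RatFunc.C c) = 0 := by
  rw [ratDerivation_apply, ← RatFunc.algebraMap_C, ratDeriv_algebraMap]
  simp

/-! ### The Toda equation in a differential field -/

section Toda

variable {k K : Type*} [Field k] [Field K] [Algebra k K] (D : Derivation k K K) (z : K)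

/-- The logarithmic derivative `z f' / f`. -/
def eulerLogDeriv (f : K) : K := z * D f / f

theorem eulerLogDeriv_mul {f g : K} (hf : f ≠ 0) (hg : g ≠ 0) :
    eulerLogDeriv D z (f * g) = eulerLogDeriv D z f + eulerLogDeriv D z g := by
  simp only [eulerLogDeriv, Derivation.leibniz, smul_eq_mul]
  field_simp
  ring

theorem eulerLogDeriv_inv {f : K} (hf : f ≠ 0) :
    eulerLogDeriv D z f⁻¹ = -eulerLogDeriv D z f := by
  simp only [eulerLogDeriv, Derivation.leibniz_inv, smul_eq_mul]
  field_simp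

theorem eulerLogDeriv_div {f g : K} (hf : f ≠ 0) (hg : g ≠ 0) :
    eulerLogDeriv D z (f / g) = eulerLogDeriv D z f - eulerLogDeriv D z g := by
  rw [div_eq_mul_inv, eulerLogDeriv_mul D z hf (inv_ne_zero hg), eulerLogDeriv_inv D z hg,
    sub_eq_add_neg]

theorem eulerLogDeriv_one : eulerLogDeriv D z 1 = 0 := by
  simp [eulerLogDeriv]

theorem eulerLogDeriv_self_zpow {z : K} (hDz : D z = 1) (hz : z ≠ 0) (k : ℤ) :
    eulerLogDeriv D z (z ^ k) = k := by
  rw [eulerLogDeriv, Derivation.leibniz_zpow, hDz, div_eq_iff (zpow_ne_zero k hz),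
    zpow_sub_one₀ hz]
  simp only [smul_eq_mul, zsmul_eq_mul]
  field_simp

/-- The ratio `S_{n+1} S_{n-1} / S_n²` in terms of the logarithmic derivative of `S_n`. -/
theorem toda_div_sq {z : K} (hDz : D z = 1) (c : K) {S R : K} (hS : S ≠ 0)
    (hR : R = -z * (S * D (D S) - D S ^ 2) - S * D S + (z + c) * S ^ 2) :
    R / S ^ 2 = z + c - D (eulerLogDeriv D z S) := by
  rw [hR, eulerLogDeriv, Derivation.leibniz_div]
  simp only [Derivation.leibniz, smul_eq_mul, hDz]
  field_simp
  ring

variable {D z} {c : K} {u F : ℕ → K}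

/-- First integrals of the Toda chain starting from `u₀ = u₁ = 0`. -/
theorem toda_integrals [CharZero K] (hDz : D z = 1) (hc : D c = 0) (hu0 : u 0 = 0) (hu1 : u 1 = 0)
    (hF : ∀ n, F n ≠ 0) (hFu : ∀ n, F n = z + c - D (u (n + 1)))
    (hDF : ∀ n, z * D (F n) = F n * (u (n + 2) - 2 * u (n + 1) + u n)) (n : ℕ) :
    F n * (u (n + 2) - u n) = (2 * n + 1) * z ∧
      u (n + 2) + u (n + 1) - z * D (u (n + 2) + u (n + 1)) = (u (n + 2) - u (n + 1)) ^ 2 := by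
  have hnat (k : ℕ) : D (k : K) = 0 := Derivation.map_natCast D k
  have h2 : D (2 : K) = 0 := by exact_mod_cast hnat 2
  have hDF' (n : ℕ) : D (F n) = 1 - D (D (u (n + 1))) := by
    rw [hFu, map_sub, map_add, hDz, hc, add_zero]
  induction n with
  | zero =>
    have hI : F 0 * u 2 = z := by
      have h := hDF 0
      rw [hDF'] at h
      simp only [zero_add, hu0, hu1, map_zero] at h
      linear_combination -h
    refine ⟨by simpa [hu0] using hI, ?_⟩
    have hD := congrArg D hI
    rw [Derivation.leibniz, hDF' 0, hDz] at hD
    simp only [zero_add, add_zero, hu1, map_zero, smul_eq_mul] at hD ⊢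
    refine mul_left_cancel₀ (pow_ne_zero 2 (hF 0)) ?_
    linear_combination (F 0 - F 0 * u 2) * hI - z * F 0 * hD
  | succ n ih =>
    obtain ⟨hI, hE⟩ := ih
    have hw := hDF n
    rw [hDF' n] at hw
    -- Differentiating the second integral at `n` gives the first one at `n + 1`; the second is
    -- carried along to close the induction.
    have hI' : F (n + 1) * (u (n + 3) - u (n + 1)) = (2 * ((n + 1 : ℕ) : K) + 1) * z := by
      have hD := congrArg D hE
      simp only [map_add, map_sub, Derivation.leibniz, Derivation.leibniz_pow, smul_eq_mul, hDz,
        nsmul_eq_mul, Nat.cast_ofNat, Nat.add_one_sub_one, pow_one] at hD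
      have h1 := hDF (n + 1)
      rw [hDF' (n + 1)] at h1
      have e0 := hFu n
      have e1 := hFu (n + 1)
      push_cast
      have e2 : F (n + 1) = F n - (D (u (n + 2)) - D (u (n + 1))) := by
        rw [e0, e1]; ring
      have e3 : F (n + 1) * (u (n + 3) - u (n + 1)) = z * (1 - D (D (u (n + 2)))) +
          2 * (F n - (D (u (n + 2)) - D (u (n + 1)))) * (u (n + 2) - u (n + 1)) := by
        rw [← e2]; linear_combination -h1
      rw [e3]
      linear_combination hI - hw + hD
    refine ⟨hI', ?_⟩
    -- Conversely, the derivative of the new first integral turns the second integral at `n` into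
    -- the one at `n + 1`.
    have hD := congrArg D hI'
    have h1 := hDF (n + 1)
    simp only [map_add, map_sub, Derivation.leibniz, smul_eq_mul, hDz, hnat, h2,
      Derivation.map_one_eq_zero] at hD hE ⊢
    refine mul_left_cancel₀ (hF (n + 1)) ?_
    push_cast at hD hI'
    simp only [show n + 1 + 2 = n + 3 from rfl, show n + 1 + 1 = n + 2 from rfl] at *
    linear_combination F (n + 1) * hE + hI' - z * hD + (u (n + 3) - u (n + 1)) * h1

end Toda

/-! ### Taylor expansions at the origin -/

open scoped RatFunc

/-- `U` is the Taylor series of `f` at the origin. -/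
def HasExpansion (f : RatFunc ℂ) (U : PowerSeries ℂ) : Prop :=
  algebraMap (RatFunc ℂ) (LaurentSeries ℂ) f = HahnSeries.ofPowerSeries ℤ ℂ U

namespace HasExpansion

variable {f g : RatFunc ℂ} {U V : PowerSeries ℂ}

theorem unique (hU : HasExpansion f U) (hV : HasExpansion f V) : U = V :=
  HahnSeries.ofPowerSeries_injective (hU.symm.trans hV)

theorem of_polynomial (p : Polynomial ℂ) :
    HasExpansion (algebraMap (Polynomial ℂ) (RatFunc ℂ) p) (p : PowerSeries ℂ) :=
  (RatFunc.coe_coe p).symm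

theorem X : HasExpansion RatFunc.X PowerSeries.X := by
  simpa using of_polynomial Polynomial.X

theorem C (c : ℂ) : HasExpansion (RatFunc.C c) (PowerSeries.C c) := by
  simpa using of_polynomial (Polynomial.C c)

theorem add (hf : HasExpansion f U) (hg : HasExpansion g V) : HasExpansion (f + g) (U + V) := by
  unfold HasExpansion at *
  rw [map_add, map_add, hf, hg]

theorem sub (hf : HasExpansion f U) (hg : HasExpansion g V) : HasExpansion (f - g) (U - V) := by
  unfold HasExpansion at *
  rw [map_sub, map_sub, hf, hg]

theorem mul (hf : HasExpansion f U) (hg : HasExpansion g V) : HasExpansion (f * g) (U * V) := by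
  unfold HasExpansion at *
  rw [map_mul, map_mul, hf, hg]

theorem div_polynomial {p q : Polynomial ℂ} (hq : q.coeff 0 ≠ 0) :
    HasExpansion (algebraMap (Polynomial ℂ) (RatFunc ℂ) p / algebraMap (Polynomial ℂ) (RatFunc ℂ) q)
      (p * (q : PowerSeries ℂ)⁻¹) := by
  have hq0 : q ≠ 0 := by rintro rfl; simp at hq
  have hq' : algebraMap (RatFunc ℂ) (LaurentSeries ℂ) (algebraMap (Polynomial ℂ) (RatFunc ℂ) q) ≠ 0 :=
    (map_ne_zero _).2 (RatFunc.algebraMap_ne_zero hq0)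
  unfold HasExpansion
  rw [map_div₀, div_eq_iff hq', of_polynomial q, of_polynomial p, ← map_mul, mul_assoc,
    PowerSeries.inv_mul_cancel _ (by simpa using hq), mul_one]

/-- Differentiate `f.num = U * f.denom` as power series and cancel `f.denom ^ 2` among Laurent
series; `f.denom` need not be a unit power series. -/
theorem derivation (hf : HasExpansion f U) :
    HasExpansion (ratDerivation f) (PowerSeries.derivative ℂ U) := by
  have hq : f.denom ≠ 0 := f.denom_ne_zero
  have hq' := RatFunc.algebraMap_ne_zero hq
  have h1 : (f.num : PowerSeries ℂ) = U * f.denom := by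
    refine (of_polynomial f.num).unique ?_
    have := hf.mul (of_polynomial f.denom)
    rwa [show f * algebraMap _ _ f.denom = algebraMap _ _ f.num by
      conv_lhs => enter [1]; rw [← RatFunc.num_div_denom f]
      rw [div_mul_cancel₀ _ hq']] at this
  have h2 := congrArg (PowerSeries.derivative ℂ) h1
  rw [PowerSeries.derivative_coe, Derivation.leibniz, PowerSeries.derivative_coe] at h2
  simp only [smul_eq_mul] at h2
  have h3 : ratDerivation f * algebraMap _ _ (f.denom ^ 2) = algebraMap _ _
      (Polynomial.derivative f.num * f.denom - f.num * Polynomial.derivative f.denom) := by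
    rw [ratDerivation_apply, ratDeriv, div_mul_cancel₀]
    exact RatFunc.algebraMap_ne_zero (pow_ne_zero 2 hq)
  have h4 := congrArg (algebraMap (RatFunc ℂ) (LaurentSeries ℂ)) h3
  rw [map_mul, of_polynomial, of_polynomial] at h4
  refine mul_right_cancel₀ (b := HahnSeries.ofPowerSeries ℤ ℂ ((f.denom ^ 2 : Polynomial ℂ))) ?_ ?_
  · rw [Ne, map_eq_zero_iff _ HahnSeries.ofPowerSeries_injective]
    exact_mod_cast pow_ne_zero 2 hq
  · rw [h4, ← map_mul]
    congr 1
    push_cast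
    rw [h2, h1]
    ring

end HasExpansion

/-- Write $p=z^kq$ with $q(0)\ne0$; then $zp'/p=k+zq'/q$, and $q$ is invertible as a power series.
-/
theorem exists_hasExpansion_eulerLogDeriv_polynomial (p : Polynomial ℂ) (hp : p ≠ 0) :
    ∃ U, HasExpansion
      (eulerLogDeriv ratDerivation RatFunc.X (algebraMap (Polynomial ℂ) (RatFunc ℂ) p)) U := by
  obtain ⟨q, hpq, hq⟩ := p.exists_eq_pow_rootMultiplicity_mul_and_not_dvd hp 0
  rw [Polynomial.C_0, sub_zero] at hpq hq
  rw [Polynomial.X_dvd_iff] at hq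
  have hq0 : q ≠ 0 := by rintro rfl; simp at hq
  have hX : (RatFunc.X : RatFunc ℂ) ≠ 0 := RatFunc.X_ne_zero
  have h := (HasExpansion.C (p.rootMultiplicity 0 : ℂ)).add
    (HasExpansion.div_polynomial (p := Polynomial.X * Polynomial.derivative q) hq)
  rw [map_natCast] at h
  rw [hpq, map_mul, map_pow, RatFunc.algebraMap_X,
    eulerLogDeriv_mul _ _ (pow_ne_zero _ hX) (RatFunc.algebraMap_ne_zero hq0), ← zpow_natCast,
    eulerLogDeriv_self_zpow _ ratDerivation_X hX, Int.cast_natCast, eulerLogDeriv,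
    ratDerivation_apply, ratDeriv_algebraMap, ← RatFunc.algebraMap_X, ← map_mul]
  exact ⟨_, h⟩

/-- The logarithmic derivative `z f' / f` of a rational function is regular at the origin. -/
theorem exists_hasExpansion_eulerLogDeriv (f : RatFunc ℂ) (hf : f ≠ 0) :
    ∃ U, HasExpansion (eulerLogDeriv ratDerivation RatFunc.X f) U := by
  obtain ⟨U, hU⟩ := exists_hasExpansion_eulerLogDeriv_polynomial f.num (RatFunc.num_ne_zero hf)
  obtain ⟨V, hV⟩ := exists_hasExpansion_eulerLogDeriv_polynomial f.denom f.denom_ne_zero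
  refine ⟨U - V, ?_⟩
  rw [← RatFunc.num_div_denom f, eulerLogDeriv_div _ _
    (RatFunc.algebraMap_ne_zero (RatFunc.num_ne_zero hf))
    (RatFunc.algebraMap_ne_zero f.denom_ne_zero)]
  exact hU.sub hV

/-! ### The first Taylor coefficients -/

section Coefficients

variable {μ : ℤ} {a b c r : ℕ → ℂ}

/-- Below the critical index, consecutive gaps `μ - b n` multiply to `μ² - n²`. -/
theorem toda_coeff_subcritical (ha0 : a 0 = 0) (ha1 : a 1 = 0) (hb0 : b 0 = 0) (hb1 : b 1 = 0)
    (h0 : ∀ n, (μ - b (n + 1)) * (a (n + 2) - a n) = 0)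
    (h1 : ∀ n, (μ - b (n + 1)) * (b (n + 2) - b n) + (1 - 2 * c (n + 1)) * (a (n + 2) - a n) =
      2 * n + 1) (n : ℕ) (hn : n ≤ μ.natAbs) :
    a n = 0 ∧ a (n + 1) = 0 ∧ (μ - b (n + 1)) * (μ - b n) = (μ : ℂ) ^ 2 - (n : ℂ) ^ 2 := by
  induction n with
  | zero => exact ⟨ha0, ha1, by rw [zero_add, hb0, hb1]; push_cast; ring⟩
  | succ n ih =>
    obtain ⟨an, an1, hp⟩ := ih (by omega)
    have hlt : (n : ℤ) ^ 2 < μ ^ 2 := by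
      rw [← Int.natAbs_sq μ]
      exact_mod_cast Nat.pow_lt_pow_left hn two_ne_zero
    -- A zero gap would force $\mu^2=n^2$, which $n<|\mu|$ excludes.
    have hne : (μ : ℂ) - b (n + 1) ≠ 0 := by
      intro h
      rw [h, zero_mul] at hp
      have : (μ : ℂ) ^ 2 = (n : ℂ) ^ 2 := by linear_combination -hp
      have : μ ^ 2 = (n : ℤ) ^ 2 := by exact_mod_cast this
      omega
    have an2 : a (n + 2) = a n :=
      sub_eq_zero.1 ((mul_eq_zero.1 (h0 n)).resolve_left hne)
    refine ⟨an1, an2.trans an, ?_⟩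
    have h := h1 n
    rw [an2, sub_self, mul_zero, add_zero] at h
    push_cast
    linear_combination hp - h

/-- At and above the critical index `|μ|`, the linear coefficient is locked at `μ`. -/
theorem toda_coeff_supercritical (hμ : μ ≠ 0) (ha0 : a 0 = 0) (ha1 : a 1 = 0) (hb0 : b 0 = 0)
    (hb1 : b 1 = 0)
    (h0 : ∀ n, (μ - b (n + 1)) * (a (n + 2) - a n) = 0)
    (h1 : ∀ n, (μ - b (n + 1)) * (b (n + 2) - b n) + (1 - 2 * c (n + 1)) * (a (n + 2) - a n) =
      2 * n + 1)
    (h2 : ∀ n, (μ - b (n + 1)) * (c (n + 2) - c n) + (1 - 2 * c (n + 1)) * (b (n + 2) - b n) +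
      r n * (a (n + 2) - a n) = 0)
    (k1 : ∀ n, 1 - 2 * c (n + 1) = (μ - b (n + 1)) * (b (n + 2) - 2 * b (n + 1) + b n) +
      (1 - 2 * c (n + 1)) * (a (n + 2) - 2 * a (n + 1) + a n))
    (k2 : ∀ n, 2 * r n = (μ - b (n + 1)) * (c (n + 2) - 2 * c (n + 1) + c n) +
      (1 - 2 * c (n + 1)) * (b (n + 2) - 2 * b (n + 1) + b n) +
      r n * (a (n + 2) - 2 * a (n + 1) + a n)) (m : ℕ) :
    b (μ.natAbs + m + 1) = μ ∧
      (2 * m + 1) * (1 - 2 * c (μ.natAbs + m + 1)) = 2 * (μ.natAbs + m : ℂ) + 1 := by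
  have hsq : (μ : ℂ) ^ 2 = (μ.natAbs : ℂ) ^ 2 := by
    rw [← Int.cast_natCast μ.natAbs, ← Int.cast_pow, ← Int.cast_pow, Int.natAbs_sq]
  -- At $m=0$ the value $b_{|\mu|}$ is not $\mu$, hence the disjunction; it is harmless, as this
  -- value enters with the factor $2m$.
  have key (m : ℕ) : a (μ.natAbs + m) = m * (m - 1) / 2 ∧ a (μ.natAbs + m + 1) = m * (m + 1) / 2 ∧
      b (μ.natAbs + m + 1) = μ ∧ ((m : ℂ) = 0 ∨ b (μ.natAbs + m) = μ) →
      (2 * m + 1) * (1 - 2 * c (μ.natAbs + m + 1)) = 2 * (μ.natAbs + m : ℂ) + 1 ∧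
      a (μ.natAbs + m + 2) = (m + 1) * (m + 2) / 2 ∧ b (μ.natAbs + m + 2) = μ := by
    rintro ⟨e0, e1, e2, e3⟩
    have g1 := h1 (μ.natAbs + m)
    have g2 := h2 (μ.natAbs + m)
    have l1 := k1 (μ.natAbs + m)
    have l2 := k2 (μ.natAbs + m)
    rw [e2, sub_self, zero_mul, zero_add] at g1 g2 l1 l2
    -- The constant term of $F$ is now zero and its linear coefficient is not, so the latter can be
    -- cancelled; the chain equation then makes the second difference of `a` equal to 1.
    have hq : 1 - 2 * c (μ.natAbs + m + 1) ≠ 0 := by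
      intro h
      rw [h, zero_mul] at g1
      have : (2 * (μ.natAbs + m) + 1 : ℕ) = (0 : ℂ) := by push_cast at g1 ⊢; exact g1.symm
      exact Nat.cast_ne_zero.2 (by omega) this
    have hs : a (μ.natAbs + m + 2) - 2 * a (μ.natAbs + m + 1) + a (μ.natAbs + m) = 1 :=
      mul_left_cancel₀ hq (by rw [← l1, mul_one])
    have ea : a (μ.natAbs + m + 2) = (m + 1) * (m + 2) / 2 := by
      linear_combination hs + 2 * e1 - e0
    have hd : a (μ.natAbs + m + 2) - a (μ.natAbs + m) = 2 * m + 1 := by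
      rw [ea, e0]; ring
    rw [hs] at l2
    rw [hd] at g1 g2
    push_cast at g1
    refine ⟨by linear_combination g1, ea, ?_⟩
    -- By `l2`, `r` is the linear coefficient of $F$ times the second difference of `b`. Eliminating
    -- `r` leaves $(2m+2)b_{|\mu|+m+2}+2m\,b_{|\mu|+m}=2(2m+1)\mu$.
    have hbb : b (μ.natAbs + m + 2) - b (μ.natAbs + m) +
        (2 * m + 1) * (b (μ.natAbs + m + 2) - 2 * μ + b (μ.natAbs + m)) = 0 :=
      mul_left_cancel₀ hq (by linear_combination g2 - (2 * m + 1) * l2)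
    have hm : (2 * m + 2 : ℂ) ≠ 0 := by exact_mod_cast (by omega : 2 * m + 2 ≠ 0)
    refine mul_left_cancel₀ hm ?_
    rcases e3 with e3 | e3
    · rw [e3] at hbb ⊢
      linear_combination hbb
    · rw [e3] at hbb
      linear_combination hbb
  -- The gap products at $N=|\mu|-1$ and at $|\mu|$ share the factor $\mu-b_{|\mu|}$. The first
  -- product is $2N+1\ne0$, so the other factor of the second one vanishes.
  have base : b (μ.natAbs + 1) = μ := by
    obtain ⟨N, hN⟩ : ∃ N, μ.natAbs = N + 1 := Nat.exists_eq_succ_of_ne_zero (Int.natAbs_ne_zero.2 hμ)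
    have p1 := (toda_coeff_subcritical ha0 ha1 hb0 hb1 h0 h1 N (by omega)).2.2
    have p2 := (toda_coeff_subcritical ha0 ha1 hb0 hb1 h0 h1 (N + 1) (by omega)).2.2
    rw [hsq, hN] at p1 p2
    rw [hN]
    rw [sub_self] at p2
    refine (sub_eq_zero.1 ((mul_eq_zero.1 p2).resolve_right ?_)).symm
    intro h
    rw [h, zero_mul] at p1
    have : ((2 * N + 1 : ℕ) : ℂ) = 0 := by push_cast at p1 ⊢; linear_combination -p1
    exact Nat.cast_ne_zero.2 (by omega) this
  have main (m : ℕ) : a (μ.natAbs + m) = m * (m - 1) / 2 ∧ a (μ.natAbs + m + 1) = m * (m + 1) / 2 ∧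
      b (μ.natAbs + m + 1) = μ ∧ ((m : ℂ) = 0 ∨ b (μ.natAbs + m) = μ) := by
    induction m with
    | zero =>
      obtain ⟨p, q, -⟩ := toda_coeff_subcritical ha0 ha1 hb0 hb1 h0 h1 _ le_rfl
      exact ⟨by simpa using p, by simpa using q, base, Or.inl Nat.cast_zero⟩
    | succ m ih =>
      obtain ⟨-, q, s⟩ := key m ih
      refine ⟨?_, ?_, s, Or.inr ih.2.2.1⟩
      · rw [← add_assoc, ih.2.1]; push_cast; ring
      · rw [← add_assoc, q]; push_cast; ring
  exact ⟨(main m).2.2.1, (key m (main m)).1⟩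

end Coefficients

/-- The first Taylor coefficients of the logarithmic derivatives `z S_n' / S_n`, `n ≥ |μ|`. -/
theorem toda_powerSeries_coeff {μ : ℤ} (hμ : μ ≠ 0) {U F : ℕ → PowerSeries ℂ} (hU0 : U 0 = 0)
    (hU1 : U 1 = 0)
    (hF : ∀ n, F n = PowerSeries.X + PowerSeries.C (μ : ℂ) - PowerSeries.derivative ℂ (U (n + 1)))
    (hI : ∀ n : ℕ, F n * (U (n + 2) - U n) = PowerSeries.C (2 * n + 1 : ℂ) * PowerSeries.X)
    (hD : ∀ n, PowerSeries.X * PowerSeries.derivative ℂ (F n) =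
      F n * (U (n + 2) - PowerSeries.C 2 * U (n + 1) + U n)) (m : ℕ) :
    (U (μ.natAbs + m + 1)).coeff 1 = μ ∧
      (2 * m + 1) * (1 - 2 * (U (μ.natAbs + m + 1)).coeff 2) = 2 * (μ.natAbs + m : ℂ) + 1 := by
  have f0 (n) : (F n).coeff 0 = μ - (U (n + 1)).coeff 1 := by
    rw [hF, map_sub, map_add, PowerSeries.coeff_derivative, PowerSeries.coeff_C]
    simp
  have f1 (n) : (F n).coeff 1 = 1 - 2 * (U (n + 1)).coeff 2 := by
    rw [hF, map_sub, map_add, PowerSeries.coeff_derivative, PowerSeries.coeff_C]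
    simp
    ring
  have anti1 (A B : PowerSeries ℂ) :
      (A * B).coeff 1 = A.coeff 0 * B.coeff 1 + A.coeff 1 * B.coeff 0 := by
    rw [PowerSeries.coeff_mul, Finset.Nat.sum_antidiagonal_eq_sum_range_succ_mk]
    simp [Finset.sum_range_succ]
  have anti2 (A B : PowerSeries ℂ) : (A * B).coeff 2 =
      A.coeff 0 * B.coeff 2 + A.coeff 1 * B.coeff 1 + A.coeff 2 * B.coeff 0 := by
    rw [PowerSeries.coeff_mul, Finset.Nat.sum_antidiagonal_eq_sum_range_succ_mk]
    simp [Finset.sum_range_succ]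
  have anti0 (A B : PowerSeries ℂ) : (A * B).coeff 0 = A.coeff 0 * B.coeff 0 := by simp
  refine toda_coeff_supercritical (a := fun n => (U n).coeff 0) (b := fun n => (U n).coeff 1)
    (c := fun n => (U n).coeff 2) (r := fun n => (F n).coeff 2) hμ (by simp [hU0]) (by simp [hU1])
    (by simp [hU0]) (by simp [hU1]) ?_ ?_ ?_ ?_ ?_ m
  · intro n
    have := congrArg (PowerSeries.coeff 0) (hI n)
    rw [anti0, f0, map_sub] at this
    simpa using this
  · intro n
    have := congrArg (PowerSeries.coeff 1) (hI n)
    rw [anti1, f0, f1, map_sub, map_sub, PowerSeries.coeff_C_mul] at this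
    simpa using this
  · intro n
    have := congrArg (PowerSeries.coeff 2) (hI n)
    rw [anti2, f0, f1, map_sub, map_sub, map_sub, PowerSeries.coeff_C_mul] at this
    simpa [PowerSeries.coeff_X] using this
  · intro n
    have := congrArg (PowerSeries.coeff 1) (hD n)
    rw [anti1, anti1, f0, f1] at this
    simp only [map_add, map_sub, PowerSeries.coeff_C_mul, PowerSeries.coeff_derivative, f1] at this
    simpa using this
  · intro n
    have := congrArg (PowerSeries.coeff 2) (hD n)
    rw [anti2, anti2, f0, f1] at this
    simp only [map_add, map_sub, PowerSeries.coeff_C_mul, PowerSeries.coeff_derivative, f1] at this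
    simpa [PowerSeries.coeff_X, mul_comm, one_add_one_eq_two] using this

/-! ### The rational functions `S_n` -/

/-- The sequence `S_{-1}, S_0, S_1, …`. -/
def umemuraShift (μ : ℂ) : ℕ → RatFunc ℂ
  | 0 => 1
  | n + 1 => umemuraS μ n

theorem umemuraShift_ne_zero (μ : ℂ) : ∀ n, umemuraShift μ n ≠ 0
  | 0 => one_ne_zero
  | n + 1 => umemuraS_ne_zero μ n

theorem umemuraShift_mul (μ : ℂ) : ∀ n, umemuraShift μ (n + 2) * umemuraShift μ n =
    umemuraRHS μ (umemuraShift μ (n + 1))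
  | 0 => by simp [umemuraShift, umemuraS]
  | n + 1 => umemuraS_mul μ n

/-- The logarithmic derivative `z S' / S` along the shifted sequence. -/
def umemuraLogDeriv (μ : ℂ) (n : ℕ) : RatFunc ℂ :=
  eulerLogDeriv ratDerivation RatFunc.X (umemuraShift μ n)

/-- The ratio `S_{n+1} S_{n-1} / S_n²`. -/
def umemuraRatio (μ : ℂ) (n : ℕ) : RatFunc ℂ :=
  umemuraShift μ (n + 2) * umemuraShift μ n / umemuraShift μ (n + 1) ^ 2

theorem umemuraRatio_ne_zero (μ : ℂ) (n : ℕ) : umemuraRatio μ n ≠ 0 :=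
  div_ne_zero (mul_ne_zero (umemuraShift_ne_zero μ _) (umemuraShift_ne_zero μ _))
    (pow_ne_zero 2 (umemuraShift_ne_zero μ _))

theorem umemuraRatio_eq (μ : ℂ) (n : ℕ) :
    umemuraRatio μ n = RatFunc.X + RatFunc.C μ - ratDerivation (umemuraLogDeriv μ (n + 1)) := by
  rw [umemuraRatio, umemuraShift_mul]
  exact toda_div_sq ratDerivation ratDerivation_X (RatFunc.C μ) (umemuraShift_ne_zero μ _) rfl

theorem X_mul_ratDerivation_umemuraRatio (μ : ℂ) (n : ℕ) :
    RatFunc.X * ratDerivation (umemuraRatio μ n) = umemuraRatio μ n *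
      (umemuraLogDeriv μ (n + 2) - 2 * umemuraLogDeriv μ (n + 1) + umemuraLogDeriv μ n) := by
  have h : eulerLogDeriv ratDerivation RatFunc.X (umemuraRatio μ n) =
      umemuraLogDeriv μ (n + 2) - 2 * umemuraLogDeriv μ (n + 1) + umemuraLogDeriv μ n := by
    have h0 := umemuraShift_ne_zero μ n
    have h1 := umemuraShift_ne_zero μ (n + 1)
    have h2 := umemuraShift_ne_zero μ (n + 2)
    rw [umemuraRatio, eulerLogDeriv_div _ _ (mul_ne_zero h2 h0) (pow_ne_zero 2 h1),
      eulerLogDeriv_mul _ _ h2 h0, sq, eulerLogDeriv_mul _ _ h1 h1]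
    simp only [umemuraLogDeriv]
    ring
  rw [← h, eulerLogDeriv, mul_div_cancel₀ _ (umemuraRatio_ne_zero μ n)]

theorem umemuraLogDeriv_zero (μ : ℂ) : umemuraLogDeriv μ 0 = 0 := eulerLogDeriv_one _ _

theorem umemuraLogDeriv_one (μ : ℂ) : umemuraLogDeriv μ 1 = 0 := by
  rw [umemuraLogDeriv, umemuraShift, umemuraS, eulerLogDeriv_one]

/-- `S_{n+1}' S_{n-1} - S_{n+1} S_{n-1}' = (2n+1) S_n²`, written with logarithmic derivatives. -/
theorem umemuraRatio_mul_sub (μ : ℂ) (n : ℕ) :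
    umemuraRatio μ n * (umemuraLogDeriv μ (n + 2) - umemuraLogDeriv μ n) =
      (2 * (n : RatFunc ℂ) + 1) * RatFunc.X := by
  have : CharZero (RatFunc ℂ) := algebraRat.charZero _
  exact (toda_integrals ratDerivation_X (ratDerivation_C μ) (umemuraLogDeriv_zero μ)
    (umemuraLogDeriv_one μ) (umemuraRatio_ne_zero μ) (umemuraRatio_eq μ)
    (X_mul_ratDerivation_umemuraRatio μ) n).1

/-- The Toda identities in $\mathbb{C}(z)$ pass to Taylor series by uniqueness of expansions, which
reduces the claim to `toda_powerSeries_coeff`. -/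
theorem exists_umemuraLogDeriv_expansion {μ : ℤ} (hμ : μ ≠ 0) (m : ℕ) :
    ∃ U, HasExpansion (umemuraLogDeriv μ (μ.natAbs + m + 1)) U ∧ U.coeff 1 = μ ∧
      (2 * m + 1) * (1 - 2 * U.coeff 2) = 2 * (μ.natAbs + m : ℂ) + 1 := by
  choose U hU using fun n =>
    exists_hasExpansion_eulerLogDeriv (umemuraShift (μ : ℂ) n) (umemuraShift_ne_zero _ n)
  change ∀ n, HasExpansion (umemuraLogDeriv μ n) (U n) at hU
  have hzero : HasExpansion 0 0 := by simpa using HasExpansion.C 0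
  have hF (n : ℕ) : HasExpansion (umemuraRatio μ n)
      (PowerSeries.X + PowerSeries.C (μ : ℂ) - PowerSeries.derivative ℂ (U (n + 1))) := by
    rw [umemuraRatio_eq]
    exact (HasExpansion.X.add (HasExpansion.C _)).sub (hU _).derivation
  refine ⟨_, hU _, toda_powerSeries_coeff hμ ?_ ?_ (fun _ => rfl) ?_ ?_ m⟩
  · exact (hU 0).unique (by rw [umemuraLogDeriv_zero]; exact hzero)
  · exact (hU 1).unique (by rw [umemuraLogDeriv_one]; exact hzero)
  · intro n
    refine ((hF n).mul ((hU (n + 2)).sub (hU n))).unique ?_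
    rw [umemuraRatio_mul_sub]
    have h := (HasExpansion.C (2 * n + 1)).mul HasExpansion.X
    rwa [map_add RatFunc.C, map_mul RatFunc.C, map_ofNat, map_natCast, map_one] at h
  · intro n
    refine (HasExpansion.X.mul (hF n).derivation).unique ?_
    rw [X_mul_ratDerivation_umemuraRatio]
    have h := (hF n).mul (((hU (n + 2)).sub ((HasExpansion.C 2).mul (hU (n + 1)))).add (hU n))
    rwa [map_ofNat] at h

/-- If `f = z^σ g`, then `g (z f' / f - σ) = z g'` as power series. -/
theorem coe_mul_expansion_eq {f : RatFunc ℂ} {σ : ℤ} {g : Polynomial ℂ} (hg : g ≠ 0)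
    (hf : f = RatFunc.X ^ σ * algebraMap (Polynomial ℂ) (RatFunc ℂ) g) {U : PowerSeries ℂ}
    (hU : HasExpansion (eulerLogDeriv ratDerivation RatFunc.X f) U) :
    (g : PowerSeries ℂ) * (U - PowerSeries.C (σ : ℂ)) =
      PowerSeries.X * PowerSeries.derivative ℂ (g : PowerSeries ℂ) := by
  refine ((HasExpansion.of_polynomial g).mul (hU.sub (HasExpansion.C _))).unique ?_
  have hg' := RatFunc.algebraMap_ne_zero hg
  rw [hf, eulerLogDeriv_mul _ _ (zpow_ne_zero _ RatFunc.X_ne_zero) hg',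
    eulerLogDeriv_self_zpow _ ratDerivation_X RatFunc.X_ne_zero, map_intCast, add_sub_cancel_left,
    eulerLogDeriv, mul_div_cancel₀ _ hg']
  exact HasExpansion.X.mul (HasExpansion.of_polynomial g).derivation

end

theorem theorem4p4 (μ : ℤ) (hμ : μ ≠ 0) (n : ℕ) (hn : |μ| ≤ (n : ℤ)) (σ : ℤ)
    (g : Polynomial ℂ) (hg : g.coeff 0 ≠ 0)
    (hS : umemuraS (μ : ℂ) n =
      (RatFunc.X : RatFunc ℂ) ^ σ * algebraMap (Polynomial ℂ) (RatFunc ℂ) g) :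
    g.coeff 1 = (μ : ℂ) * g.coeff 0 ∧
    ((σ : ℚ) = 1 / 2 * ((n : ℚ) - |(μ : ℚ)|) * ((n : ℚ) - |(μ : ℚ)| + 1) →
      ∀ m : ℕ, (m : ℤ) = (n : ℤ) - |μ| →
        g.coeff 2 =
          1 / 2 * ((μ : ℂ) ^ 2 - ((|μ| : ℤ) : ℂ) / (2 * (m : ℂ) + 1)) * g.coeff 0) := by
  have hg0 : g ≠ 0 := by rintro rfl; simp at hg
  obtain ⟨m, rfl⟩ : ∃ m, n = μ.natAbs + m := 
    Nat.exists_eq_add_of_le (by rw [Int.abs_eq_natAbs] at hn; omega)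
  obtain ⟨U, hU, hU1, hU2⟩ := exists_umemuraLogDeriv_expansion hμ m
  have h := coe_mul_expansion_eq hg0 hS hU
  generalize (σ : ℂ) = s at h
  have c0 := congrArg (PowerSeries.coeff 0) h
  have c1 := congrArg (PowerSeries.coeff 1) h
  have c2 := congrArg (PowerSeries.coeff 2) h
  rw [PowerSeries.coeff_mul, PowerSeries.coeff_mul,
    Finset.Nat.sum_antidiagonal_eq_sum_range_succ_mk,
    Finset.Nat.sum_antidiagonal_eq_sum_range_succ_mk] at c0 c1 c2
  simp [Finset.sum_range_succ, PowerSeries.coeff_derivative, PowerSeries.coeff_X,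
    PowerSeries.coeff_C, hg] at c0 c1 c2
  rw [hU1] at c1 c2
  -- Since $g(0)\ne0$, the constant coefficient forces $\sigma=u_n(0)$, which removes the terms in
  -- $u_n(0)-\sigma$ from the next two equations.
  rw [c0] at c1 c2
  have e1 : g.coeff 1 = (μ : ℂ) * g.coeff 0 := by linear_combination -c1
  refine ⟨e1, fun _ m' hm' => ?_⟩
  obtain rfl : m' = m := by rw [Int.abs_eq_natAbs] at hm'; omega
  have hm : (2 * m' + 1 : ℂ) ≠ 0 := by exact_mod_cast (by omega : 2 * m' + 1 ≠ 0)
  rw [show ((|μ| : ℤ) : ℂ) = (μ.natAbs : ℂ) by rw [← Int.natCast_natAbs]; simp]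
  have e2 : U.coeff 2 = -(μ.natAbs / (2 * m' + 1)) := by
    field_simp
    linear_combination -hU2 / 2
  rw [e2, e1] at c2
  linear_combination -c2 / 2
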